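/- Let $G$ be a finite simple connected graph of order $n$ with girth $g$ (the length of a shortest cycle of $G$, with $g=\infty$ if $G$ is acyclic). Let $m_G(n-g+3,n]$ denote the number of eigenvalues, counted with multiplicity, of the Laplacian matrix $L(G)=D(G)-A(G)$ that lie in the interval $(n-g+3,n]$. Then $$m_G(n-g+3,n]=n-g$$ if and only if $G\cong C_3$, or $G\cong K_{3,2}$, or $G$ is isomorphic to a graph $U_1$ obtained from a cycle $C_k$ of some length $k\ge 4$ by adding one new vertex and joining it to exactly one vertex of the cycle. Here $C_3$ is the triangle and $K_{3,2}$ is the complete bipartite graph with parts of sizes $3$ and $2$. (If $g=\infty$, then $n-g=-\infty$ and the equality does not hold.) -/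

import Mathlib

open scoped ENNReal

noncomputable section

/-- `m_G I`: the number of Laplacian eigenvalues of `G`, counted with multiplicity, that lie in
the set `I`. The family `Matrix.IsHermitian.eigenvalues`, indexed by the vertices, lists every
eigenvalue of the Laplacian matrix as often as its multiplicity. -/
def laplacianEigenvalueCount {V : Type*} [Fintype V] [DecidableEq V] (G : SimpleGraph V)
    [DecidableRel G.Adj] (I : Set EReal) : ℕ :=
  Set.ncard {i : V | ((G.isHermitian_lapMatrix (R := ℝ)).eigenvalues i : EReal) ∈ I}

end

/-- The girth as an extended real number: the length of a shortest cycle, and `⊤` if the graph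
is acyclic. -/
noncomputable def girthEReal {V : Type*} (G : SimpleGraph V) : EReal :=
  ((G.egirth : ℝ≥0∞) : EReal)

/-- The cycle on the `k` vertices `some 0, …, some (k - 1)`, together with one further vertex
`none` that is joined to the vertex `some 0` of the cycle and to nothing else. -/
def cycleWithPendant (k : ℕ) : SimpleGraph (Option (Fin k)) where
  Adj
    | some i, some j => (SimpleGraph.cycleGraph k).Adj i j
    | some i, none => i.val = 0
    | none, some j => j.val = 0
    | none, none => False
  symm := by
    refine ⟨?_⟩
    rintro (_ | i) (_ | j) h
    · exact h
    · exact h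
    · exact h
    · exact h.symm
  loopless := by
    refine ⟨?_⟩
    rintro (_ | i) h
    · exact h
    · exact h.ne rfl

/-! Let `n` be the order and `g` the girth. An acyclic graph has `n - g = -∞`, which no count
equals. For `g = 3` the interval `(n, n]` is empty, so equality means `n = 3`. Let `g ≥ 4`. Adjacent
vertices have disjoint neighbourhoods, so the Anderson–Morley bound puts every eigenvalue at or
below `n`, and only the threshold `n - g + 3` matters. The heart is `eigenvalues_le`: if `g < n`, at
most one eigenvalue exceeds the threshold, because the Laplacian form is bounded by it on a
hyperplane. For `g ≥ 5`, the edges whose degree sum is too large pairwise meet; on `x u = x v`, for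
one such edge `uv`, that edge drops out of the form, and Anderson–Morley applies to what remains.
For `g = 4`, an edge of too large degree sum makes the graph bipartite, and the hyperplane is that
of sum zero over one part. Hence equality with `g < n` forces `n = g + 1`. Conversely, a vertex of
degree `d` on the shortest cycle yields an eigenvalue above `d + 1`. For `n = g` the threshold 3 is
thus exceeded and equality fails; for `n = g + 1` the cycle vertex next to the extra vertex has
degree at least 3, so the count is exactly 1. If the extra vertex has two neighbours on the cycle,
then `g = 4` and the graph is `K_{3,2}`; otherwise it is pendant. -/

/-! ### Quadratic forms and eigenvalues of symmetric matrices. -/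

open Matrix in
/-- If the quadratic form of a symmetric matrix is bounded by `T` on a hyperplane, then at most
one eigenvalue exceeds `T`. -/
theorem Matrix.IsHermitian.eigenvalues_le_of_form_le_on_hyperplane {V : Type*} [Fintype V]
    [DecidableEq V] {A : Matrix V V ℝ} (hA : A.IsHermitian) {T : ℝ} (l : V → ℝ)
    (h : ∀ x : V → ℝ, l ⬝ᵥ x = 0 → x ⬝ᵥ A *ᵥ x ≤ T * (x ⬝ᵥ x)) {i j : V} (hij : i ≠ j)
    (hi : T < hA.eigenvalues i) : hA.eigenvalues j ≤ T := by
  by_contra! hj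
  have key : ∀ a b : V, (hA.eigenvectorBasis a).ofLp ⬝ᵥ (hA.eigenvectorBasis b).ofLp
      = if a = b then 1 else 0 := fun a b => by
    have := orthonormal_iff_ite.1 hA.eigenvectorBasis.orthonormal b a
    rw [EuclideanSpace.inner_eq_star_dotProduct, star_trivial] at this
    rw [this]
    simp [eq_comm]
  -- On the span of the two eigenvectors the form exceeds `T` times the squared norm, so `l` kills
  -- no nonzero vector there; yet a functional on a plane has a nonzero kernel.
  have form : ∀ α β : ℝ, (α, β) ≠ 0 →
      α * (l ⬝ᵥ (hA.eigenvectorBasis i).ofLp) + β * (l ⬝ᵥ (hA.eigenvectorBasis j).ofLp) ≠ 0 := by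
    intro α β hne h0
    have h1 := h (α • (hA.eigenvectorBasis i).ofLp + β • (hA.eigenvectorBasis j).ofLp) (by
      simpa [dotProduct_add] using h0)
    simp only [mulVec_add, mulVec_smul, hA.mulVec_eigenvectorBasis, dotProduct_add,
      add_dotProduct, smul_dotProduct, dotProduct_smul, key, hij, hij.symm, if_true, if_false,
      smul_eq_mul] at h1
    have h2 : α ≠ 0 ∨ β ≠ 0 := by
      by_contra! hc
      exact hne (by simp [hc])
    rcases h2 with h2 | h2
    · nlinarith [mul_pos (sq_pos_of_ne_zero h2) (sub_pos.2 hi),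
        mul_nonneg (sq_nonneg β) (sub_pos.2 hj).le]
    · nlinarith [mul_pos (sq_pos_of_ne_zero h2) (sub_pos.2 hj),
        mul_nonneg (sq_nonneg α) (sub_pos.2 hi).le]
  have h0 : l ⬝ᵥ (hA.eigenvectorBasis i).ofLp = 0 := by
    by_contra hne
    exact form (l ⬝ᵥ (hA.eigenvectorBasis j).ofLp) (-(l ⬝ᵥ (hA.eigenvectorBasis i).ofLp))
      (fun hc => hne (by simpa using (Prod.ext_iff.1 hc).2)) (by ring)
  exact form 1 0 (by simp) (by simp [h0])

open Matrix in
/-- If every eigenvalue of a symmetric matrix is at most `T`, so is its Rayleigh quotient. -/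
theorem Matrix.IsHermitian.form_le_of_forall_mulVec_eq {V : Type*} [Fintype V]
    [DecidableEq V] {A : Matrix V V ℝ} (hA : A.IsHermitian) {T : ℝ}
    (h : ∀ (μ : ℝ) (x : V → ℝ), x ≠ 0 → A *ᵥ x = μ • x → μ ≤ T) (x : V → ℝ) :
    x ⬝ᵥ A *ᵥ x ≤ T * (x ⬝ᵥ x) := by
  have hB : (T • (1 : Matrix V V ℝ) - A).IsHermitian := by
    refine IsHermitian.sub ?_ hA
    simp [IsHermitian]
  have hpos : (T • (1 : Matrix V V ℝ) - A).PosSemidef := by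
    rw [hB.posSemidef_iff_eigenvalues_nonneg]
    intro i
    have h1 := hB.mulVec_eigenvectorBasis i
    have h2 := h (T - hB.eigenvalues i) (hB.eigenvectorBasis i).ofLp (by
      intro h0
      exact hB.eigenvectorBasis.orthonormal.ne_zero i (by ext k; simp [h0])) (by
      rw [sub_mulVec, smul_mulVec, one_mulVec] at h1
      rw [sub_smul, ← h1]
      abel)
    simpa using h2
  have := hpos.dotProduct_mulVec_nonneg x
  rw [star_trivial, sub_mulVec, smul_mulVec, one_mulVec, dotProduct_sub, dotProduct_smul,
    smul_eq_mul] at this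
  linarith

open Matrix in
/-- If the quadratic form of a symmetric matrix exceeds `T` somewhere, so does an eigenvalue. -/
theorem Matrix.IsHermitian.exists_lt_eigenvalues {V : Type*} [Fintype V]
    [DecidableEq V] {A : Matrix V V ℝ} (hA : A.IsHermitian) {T : ℝ} (x : V → ℝ)
    (h : T * (x ⬝ᵥ x) < x ⬝ᵥ A *ᵥ x) : ∃ i, T < hA.eigenvalues i := by
  by_contra! hle
  refine absurd (hA.form_le_of_forall_mulVec_eq (T := T) (fun μ y hy hAy => ?_) x) (not_le.2 h)
  have hmem : μ ∈ spectrum ℝ A := by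
    rw [← spectrum_toLin']
    exact Module.End.HasEigenvalue.mem_spectrum
      (Module.End.hasEigenvalue_of_hasEigenvector (x := y)
        (Module.End.hasEigenvector_iff.2 ⟨by simp [hAy], hy⟩))
  rw [hA.spectrum_real_eq_range_eigenvalues] at hmem
  obtain ⟨i, rfl⟩ := hmem
  exact hle i

/-! ### Degree bounds for Laplacian eigenvalues. -/

namespace SimpleGraph

open Matrix

variable {V : Type*} [Fintype V] [DecidableEq V] (G : SimpleGraph V) [DecidableRel G.Adj]

theorem lapMatrix_mulVec_apply_eq_sum_sub (x : V → ℝ) (v : V) :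
    (G.lapMatrix ℝ *ᵥ x) v = ∑ c ∈ G.neighborFinset v, (x v - x c) := by
  rw [lapMatrix_mulVec_apply, Finset.sum_sub_distrib, Finset.sum_const, card_neighborFinset_eq_degree,
    nsmul_eq_mul]

theorem dotProduct_lapMatrix_mulVec (x : V → ℝ) :
    x ⬝ᵥ G.lapMatrix ℝ *ᵥ x = (∑ i, ∑ j, if G.Adj i j then (x i - x j) ^ 2 else 0) / 2 := by
  rw [← lapMatrix_toLinearMap₂', toLinearMap₂'_apply']

/-- The Anderson–Morley bound: a Laplacian eigenvalue is at most the largest degree sum along an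
edge. -/
theorem eigenvalue_lapMatrix_le_of_degree_add_degree_le {M : ℕ}
    (hM : ∀ u v, G.Adj u v → G.degree u + G.degree v ≤ M) {μ : ℝ} {x : V → ℝ} (hx : x ≠ 0)
    (hLx : G.lapMatrix ℝ *ᵥ x = μ • x) : μ ≤ M := by
  by_cases hc : ∀ i j, G.Adj i j → x i = x j
  · rw [← G.lapMatrix_mulVec_eq_zero_iff_forall_adj, hLx] at hc
    rw [(smul_eq_zero.1 hc).resolve_right hx]
    positivity
  push Not at hc
  obtain ⟨a, b, hab, hne⟩ := hc
  have : Nonempty {p : V × V // G.Adj p.1 p.2} := ⟨⟨(a, b), hab⟩⟩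
  -- Take an edge with the largest difference of `x`: each `μ * x w` is a sum of `deg w`
  -- differences, none larger in absolute value. Subtracting at `u` and `v` gives the bound.
  obtain ⟨⟨⟨u, v⟩, huv : G.Adj u v⟩, hmax⟩ :=
    Finite.exists_max (fun p : {p : V × V // G.Adj p.1 p.2} => |x p.1.1 - x p.1.2|)
  replace hmax : ∀ i j, G.Adj i j → |x i - x j| ≤ |x u - x v| := fun i j hij => hmax ⟨(i, j), hij⟩
  have hpos : 0 < |x u - x v| := (abs_pos.2 (sub_ne_zero.2 hne)).trans_le (hmax a b hab)
  have hL : ∀ w, |μ * x w| ≤ G.degree w * |x u - x v| := fun w => by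
    have : μ * x w = ∑ c ∈ G.neighborFinset w, (x w - x c) := by
      rw [← lapMatrix_mulVec_apply_eq_sum_sub, hLx, Pi.smul_apply, smul_eq_mul]
    rw [this, ← card_neighborFinset_eq_degree, ← nsmul_eq_mul]
    exact (Finset.abs_sum_le_sum_abs _ _).trans
      (Finset.sum_le_card_nsmul _ _ _ fun c hc => hmax w c (by simpa using hc))
  have hMuv : (G.degree u + G.degree v : ℝ) ≤ M := mod_cast hM u v huv
  have : |μ| * |x u - x v| ≤ M * |x u - x v| := by
    calc |μ| * |x u - x v| = |μ * x u - μ * x v| := by rw [← abs_mul, mul_sub]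
      _ ≤ |μ * x u| + |μ * x v| := abs_sub _ _
      _ ≤ (G.degree u + G.degree v) * |x u - x v| := by linarith [hL u, hL v]
      _ ≤ _ := by gcongr
  exact (le_abs_self μ).trans (le_of_mul_le_mul_right this hpos)

theorem dotProduct_lapMatrix_le_of_degree_add_degree_le {M : ℕ}
    (hM : ∀ u v, G.Adj u v → G.degree u + G.degree v ≤ M) (x : V → ℝ) :
    x ⬝ᵥ G.lapMatrix ℝ *ᵥ x ≤ M * (x ⬝ᵥ x) :=
  (G.isHermitian_lapMatrix (R := ℝ)).form_le_of_forall_mulVec_eq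
    (fun _ _ hx hLx => G.eigenvalue_lapMatrix_le_of_degree_add_degree_le hM hx hLx) x

theorem eigenvalues_lapMatrix_le_of_degree_add_degree_le {M : ℕ}
    (hM : ∀ u v, G.Adj u v → G.degree u + G.degree v ≤ M) (i : V) :
    (G.isHermitian_lapMatrix (R := ℝ)).eigenvalues i ≤ M :=
  G.eigenvalue_lapMatrix_le_of_degree_add_degree_le hM
    (x := ((G.isHermitian_lapMatrix (R := ℝ)).eigenvectorBasis i).ofLp)
    (fun h0 => (G.isHermitian_lapMatrix (R := ℝ)).eigenvectorBasis.orthonormal.ne_zero i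
      (by ext k; simp [h0]))
    ((G.isHermitian_lapMatrix (R := ℝ)).mulVec_eigenvectorBasis i)

/-- Some Laplacian eigenvalue exceeds `deg v + 1`, unless the closed neighbourhood of `v` is a
component. -/
theorem exists_degree_add_one_lt_eigenvalues {u v w : V} (hvu : G.Adj v u) (huw : G.Adj u w)
    (hwv : w ≠ v) (hvw : ¬ G.Adj v w) :
    ∃ i, (G.degree v + 1 : ℝ) < (G.isHermitian_lapMatrix (R := ℝ)).eigenvalues i := by
  -- The top eigenvector of the star at `v`, with eigenvalue `deg v + 1`. The comparison holds
  -- coordinatewise, and the edge `uw` leaving the star makes it strict at `u`.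
  set x : V → ℝ := fun a => if a = v then G.degree v else if G.Adj v a then -1 else 0 with hx
  have hxv : x v = G.degree v := by simp [hx]
  have hxn : ∀ b, G.Adj v b → x b = -1 := fun b hb => by simp [hx, hb, hb.ne']
  have hx1 : ∀ b, 0 ≤ x b + 1 := fun b => by
    simp only [hx]
    split_ifs <;> positivity
  have hL : ∀ b, G.Adj v b → (G.lapMatrix ℝ *ᵥ x) b = - ∑ c ∈ G.neighborFinset b, (x c + 1) :=
    fun b hb => by
      rw [lapMatrix_mulVec_apply_eq_sum_sub, ← Finset.sum_neg_distrib, hxn b hb]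
      exact Finset.sum_congr rfl fun c _ => by ring
  apply (G.isHermitian_lapMatrix (R := ℝ)).exists_lt_eigenvalues x
  simp only [dotProduct, Finset.mul_sum]
  apply Finset.sum_lt_sum
  · intro b _
    by_cases hbv : b = v
    · subst hbv
      have : (G.lapMatrix ℝ *ᵥ x) b = G.degree b * (G.degree b + 1) := by
        rw [lapMatrix_mulVec_apply_eq_sum_sub, Finset.sum_congr rfl (g := fun _ => x b + 1)]
        · rw [Finset.sum_const, card_neighborFinset_eq_degree, nsmul_eq_mul, hxv]
        · intro c hc
          rw [hxn c (by simpa using hc)]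
          ring
      rw [this, hxv]
      exact le_of_eq (by ring)
    · by_cases hb : G.Adj v b
      · rw [hL b hb, hxn b hb]
        have := Finset.single_le_sum (f := fun c => x c + 1) (fun c _ => hx1 c)
          (show v ∈ G.neighborFinset b by simpa using hb.symm)
        simp only [hxv] at this
        linarith
      · simp [hx, hbv, hb]
  · refine ⟨u, Finset.mem_univ _, ?_⟩
    rw [hL u hvu, hxn u hvu]
    have hsub : ({v, w} : Finset V) ⊆ G.neighborFinset u := by
      intro c hc
      rcases Finset.mem_insert.1 hc with rfl | hc
      · simpa using hvu.symm
      · rw [Finset.mem_singleton.1 hc]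
        simpa using huw
    have := Finset.sum_le_sum_of_subset_of_nonneg (f := fun c => x c + 1) hsub
      (fun c _ _ => hx1 c)
    rw [Finset.sum_pair hwv.symm, hxv] at this
    have hxw : x w = 0 := by simp [hx, hwv, hvw]
    rw [hxw] at this
    linarith

end SimpleGraph

/-! ### Shortest cycles and adjacency to them. -/

namespace SimpleGraph

variable {V : Type*} {G : SimpleGraph V}

/-- Removes subtraction modulo `k`, leaving linear arithmetic for `omega`. -/
theorem cycleGraph_adj_iff_succ {k : ℕ} (hk : 2 ≤ k) {i j : Fin k} :
    (cycleGraph k).Adj i j ↔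
      (i.val + 1 = j.val ∨ j.val + 1 = i.val) ∨
        (i.val = 0 ∧ j.val + 1 = k ∨ j.val = 0 ∧ i.val + 1 = k) := by
  have hi := i.isLt
  have hj := j.isLt
  rw [cycleGraph_adj', Fin.val_sub, Fin.val_sub]
  have h : ∀ a b : ℕ, a < k → b < k → ((k - b + a) % k = 1 ↔ b + 1 = a ∨ (b + 1 = k ∧ a = 0)) := by
    intro a b ha hb
    rcases Nat.lt_or_ge (k - b + a) k with h | h
    · rw [Nat.mod_eq_of_lt h]
      omega
    · rw [Nat.mod_eq_sub_mod h, Nat.mod_eq_of_lt (by omega)]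
      omega
  rw [h _ _ hi hj, h _ _ hj hi]
  tauto

/-- A closed sequence of `m` distinct, consecutively adjacent vertices bounds the girth. -/
theorem egirth_le_of_closed_sequence {m : ℕ} (hm : 3 ≤ m) (h : ℕ → V)
    (hinj : ∀ i j, i < m → j < m → h i = h j → i = j)
    (hadj : ∀ i, i + 1 < m → G.Adj (h i) (h (i + 1))) (hclose : G.Adj (h (m - 1)) (h 0)) :
    G.egirth ≤ m := by
  have hle : cycleGraph m ⊑ G := by
    refine ⟨⟨⟨fun i => h i.val, ?_⟩, fun i j hij => Fin.ext (hinj _ _ i.isLt j.isLt hij)⟩⟩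
    intro i j hij
    have hi := i.isLt
    have hj := j.isLt
    rcases (cycleGraph_adj_iff_succ (by omega)).1 hij with (e | e) | (⟨e, e'⟩ | ⟨e, e'⟩)
    · have := hadj i (by omega)
      rwa [e] at this
    · have := hadj j (by omega)
      rw [e] at this
      exact this.symm
    · rw [show j.val = m - 1 by omega, e]
      exact hclose.symm
    · rw [show i.val = m - 1 by omega, e]
      exact hclose
  obtain ⟨v, w, hw, hl⟩ := (cycleGraph_isContained_iff (by omega)).1 hle
  rw [← hl]
  exact egirth_le_length hw

/-- `f` runs periodically through the `g` vertices of a shortest cycle of `G`. -/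
structure IsShortestCycle (G : SimpleGraph V) (g : ℕ) (f : ℕ → V) : Prop where
  adj_succ : ∀ i, G.Adj (f i) (f (i + 1))
  eq_iff : ∀ i j, f i = f j ↔ i % g = j % g
  egirth_eq : G.egirth = g

theorem exists_isShortestCycle {g : ℕ} (hg : G.egirth = g) : ∃ f, IsShortestCycle G g f := by
  have hg3 : 3 ≤ g := by
    have := three_le_egirth (G := G)
    rw [hg] at this
    exact_mod_cast this
  have hac : ¬ G.IsAcyclic := by
    rw [← egirth_eq_top, hg]
    exact ENat.natCast_ne_top g
  obtain ⟨a, w, hw, hl⟩ := exists_egirth_eq_length.2 hac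
  rw [hg] at hl
  obtain ⟨φ⟩ := (cycleGraph_isContained_iff (G := G) (n := g) (by omega)).2
    ⟨a, w, hw, by exact_mod_cast hl.symm⟩
  refine ⟨fun i => φ ⟨i % g, Nat.mod_lt _ (by omega)⟩, fun i => ?_, fun i j => ?_, hg⟩
  · apply φ.toHom.map_adj
    rw [cycleGraph_adj_iff_succ (by omega)]
    have := Nat.mod_lt i (show g > 0 by omega)
    simp only
    rw [Nat.add_mod, Nat.mod_eq_of_lt (show 1 < g by omega)]
    rcases Nat.lt_or_ge (i % g + 1) g with h | h
    · rw [Nat.mod_eq_of_lt h]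
      simp
    · rw [show i % g + 1 = g by omega, Nat.mod_self]
      simp
  · exact φ.injective.eq_iff.trans (by rw [Fin.mk.injEq])

namespace IsShortestCycle

variable {g : ℕ} {f : ℕ → V}

theorem three_le (hf : IsShortestCycle G g f) : 3 ≤ g := by
  have := three_le_egirth (G := G)
  rw [hf.egirth_eq] at this
  exact_mod_cast this

/-- Rotation lets statements about `f 0` serve for every vertex of the cycle. -/
theorem shift (hf : IsShortestCycle G g f) (a : ℕ) : IsShortestCycle G g (fun i => f (a + i)) :=
  ⟨fun i => hf.adj_succ (a + i),
    fun _ _ => (hf.eq_iff _ _).trans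
      ⟨fun h => Nat.ModEq.add_left_cancel' a h, fun h => Nat.ModEq.add_left a h⟩, hf.egirth_eq⟩

theorem injOn (hf : IsShortestCycle G g f) {i j : ℕ} (hi : i < g) (hj : j < g)
    (h : f i = f j) : i = j := by
  rwa [hf.eq_iff, Nat.mod_eq_of_lt hi, Nat.mod_eq_of_lt hj] at h

theorem period (hf : IsShortestCycle G g f) (i : ℕ) : f (i + g) = f i :=
  (hf.eq_iff _ _).2 (by simp)

theorem adj_pred (hf : IsShortestCycle G g f) : G.Adj (f 0) (f (g - 1)) := by
  have h := hf.adj_succ (g - 1)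
  have h3 := hf.three_le
  rw [show g - 1 + 1 = 0 + g by omega, hf.period] at h
  exact h.symm

theorem not_triangle (hf : IsShortestCycle G g f) (hg : 4 ≤ g) {a b c : V} (hab : G.Adj a b)
    (hbc : G.Adj b c) : ¬ G.Adj c a := by
  intro hca
  have := egirth_le_of_closed_sequence (G := G) (m := 3) le_rfl
    (fun i => if i = 0 then a else if i = 1 then b else c) (by
      intro i j hi hj hij
      have := hab.ne
      have := hbc.ne
      have := hca.ne
      interval_cases i <;> interval_cases j <;> simp_all)
    (by
      intro i hi
      obtain rfl | rfl : i = 0 ∨ i = 1 := by omega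
      · simpa
      · simpa) (by simpa)
  rw [hf.egirth_eq] at this
  have : g ≤ 3 := by exact_mod_cast this
  omega

/-- Such a chord would close a cycle of length `d + 1 < g`. -/
theorem not_adj_zero (hf : IsShortestCycle G g f) {d : ℕ} (hd : 2 ≤ d) (hdg : d + 1 < g) :
    ¬ G.Adj (f 0) (f d) := by
  intro h
  have := egirth_le_of_closed_sequence (G := G) (m := d + 1) (by omega) f
    (fun i j hi hj => hf.injOn (by omega) (by omega)) (fun i _ => hf.adj_succ i)
    (by simpa using h.symm)
  rw [hf.egirth_eq] at this
  have : g ≤ d + 1 := by exact_mod_cast this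
  omega

theorem adj_zero_iff (hf : IsShortestCycle G g f) {d : ℕ} (hd : d < g) :
    G.Adj (f 0) (f d) ↔ d = 1 ∨ d + 1 = g := by
  constructor
  · intro h
    by_contra! hc
    rcases Nat.lt_or_ge d 2 with h2 | h2
    · obtain rfl : d = 0 := by omega
      exact h.ne rfl
    · exact hf.not_adj_zero h2 (by omega) h
  · rintro (rfl | h)
    · exact hf.adj_succ 0
    · rw [show d = g - 1 by omega]
      exact hf.adj_pred

theorem adj_iff (hf : IsShortestCycle G g f) {i j : Fin g} :
    G.Adj (f i) (f j) ↔ (cycleGraph g).Adj i j := by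
  have h3 := hf.three_le
  wlog hij : i.val ≤ j.val generalizing i j
  · have key := this (i := j) (j := i) (by omega)
    rwa [G.adj_comm, (cycleGraph g).adj_comm] at key
  have hi := i.isLt
  have hj := j.isLt
  have := (hf.shift i.val).adj_zero_iff (d := j.val - i.val) (by omega)
  simp only [Nat.add_zero, show i.val + (j.val - i.val) = j.val by omega] at this
  rw [this, cycleGraph_adj_iff_succ (by omega)]
  omega

/-- A vertex off the cycle with two neighbours on it closes a cycle through either arc. -/
theorem le_of_adj_zero_of_adj (hf : IsShortestCycle G g f) {w : V} (hw : ∀ i, f i ≠ w) {d : ℕ}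
    (hd : 1 ≤ d) (hdg : d < g) (h0 : G.Adj w (f 0)) (h1 : G.Adj w (f d)) : g ≤ d + 2 := by
  have := egirth_le_of_closed_sequence (G := G) (m := d + 2) (by omega)
    (fun i => if i = d + 1 then w else f i) (by
      intro i j hi hj hij
      by_cases h : i = d + 1 <;> by_cases h' : j = d + 1
      · omega
      · simp only [h, h', if_true, if_false] at hij
        exact absurd hij.symm (hw j)
      · simp only [h, h', if_true, if_false] at hij
        exact absurd hij (hw i)
      · simp only [h, h', if_false] at hij
        exact hf.injOn (by omega) (by omega) hij)
    (by
      intro i hi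
      rw [if_neg (show i ≠ d + 1 by omega)]
      split_ifs with h
      · rw [show i = d by omega]
        exact h1.symm
      · exact hf.adj_succ i)
    (by simpa using h0)
  rw [hf.egirth_eq] at this
  exact_mod_cast this

/-- The arcs of lengths `d` and `g - d`, each closed through `w`, give `g ≤ d + 2` and `d ≤ 2`. -/
theorem eq_two_of_adj_zero_of_adj (hf : IsShortestCycle G g f) (hg : 4 ≤ g) {w : V}
    (hw : ∀ i, f i ≠ w) {d : ℕ} (hd : 1 ≤ d) (hdg : d < g) (h0 : G.Adj w (f 0))
    (h1 : G.Adj w (f d)) : g = 4 ∧ d = 2 := by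
  have a := hf.le_of_adj_zero_of_adj hw hd hdg h0 h1
  have b := (hf.shift d).le_of_adj_zero_of_adj (w := w) (fun i => hw _) (d := g - d) (by omega)
    (by omega) (by simpa using h1) (by
      rwa [show d + (g - d) = 0 + g by omega, hf.period])
  omega

theorem exists_eq_add (hf : IsShortestCycle G g f) (i j : ℕ) : ∃ d < g, f j = f (i + d) := by
  have h3 := hf.three_le
  -- `(g - 1) * i` represents `-i` modulo `g`.
  refine ⟨(j + (g - 1) * i) % g, Nat.mod_lt _ (by omega), ?_⟩
  rw [hf.eq_iff, Nat.add_mod_mod]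
  rw [show i + (j + (g - 1) * i) = j + g * i by
    obtain ⟨m, rfl⟩ : ∃ m, g = m + 1 := ⟨g - 1, by omega⟩
    simp
    ring]
  simp

/-- If the girth is at least five, a vertex off a shortest cycle has at most one neighbour on it. -/
theorem eq_of_adj_of_adj (hf : IsShortestCycle G g f) (hg : 5 ≤ g) {w : V}
    (hw : ∀ i, f i ≠ w) {i j : ℕ} (hi : G.Adj w (f i)) (hj : G.Adj w (f j)) : f i = f j := by
  obtain ⟨d, hd, e⟩ := hf.exists_eq_add i j
  rw [e] at hj ⊢
  rcases Nat.eq_zero_or_pos d with rfl | hpos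
  · rfl
  · have := (hf.shift i).eq_two_of_adj_zero_of_adj (by omega) (fun i => hw _) hpos hd hi hj
    omega

theorem eq_of_adj_cycle (hf : IsShortestCycle G g f) {i j : ℕ} (h : G.Adj (f i) (f j)) :
    f j = f (i + 1) ∨ f j = f (i + (g - 1)) := by
  obtain ⟨d, hd, e⟩ := hf.exists_eq_add i j
  rw [e] at h ⊢
  rcases ((hf.shift i).adj_zero_iff hd).1 h with rfl | h
  · exact Or.inl rfl
  · rw [show d = g - 1 by omega]
    exact Or.inr rfl

end IsShortestCycle

end SimpleGraph

/-! ### Bounding the Laplacian form on a hyperplane. -/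

namespace SimpleGraph

open Matrix Finset

section Laplacian

section Degree

variable {V : Type*} [Fintype V] {G : SimpleGraph V} [DecidableRel G.Adj]

theorem degree_deleteEdges_add_one_le {u v : V} (huv : G.Adj u v)
    [DecidableRel (G.deleteEdges {s(u, v)}).Adj] {z : V} (hz : z = u ∨ z = v) :
    (G.deleteEdges {s(u, v)}).degree z + 1 ≤ G.degree z := by
  rw [← card_neighborFinset_eq_degree, ← card_neighborFinset_eq_degree, Nat.add_one_le_iff]
  apply card_lt_card
  rw [Finset.ssubset_iff_of_subset (fun a ha => by
    rw [mem_neighborFinset] at ha ⊢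
    exact (G.deleteEdges_le _) ha)]
  rcases hz with rfl | rfl
  · exact ⟨v, by simpa, by simp [deleteEdges_adj]⟩
  · exact ⟨u, by simpa using huv.symm, by simp [deleteEdges_adj, Sym2.eq_swap]⟩

theorem degree_deleteEdges_le {s : Set (Sym2 V)} [DecidableRel (G.deleteEdges s).Adj] (z : V) :
    (G.deleteEdges s).degree z ≤ G.degree z := by
  rw [← card_neighborFinset_eq_degree, ← card_neighborFinset_eq_degree]
  exact card_le_card fun a ha => by
    rw [mem_neighborFinset] at ha ⊢
    exact (G.deleteEdges_le _) ha

end Degree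

variable {V : Type*} [Fintype V] [DecidableEq V] {G : SimpleGraph V} [DecidableRel G.Adj]

/-- On the hyperplane `x u = x v` the edge `uv` does not contribute to the Laplacian form. -/
theorem dotProduct_lapMatrix_deleteEdges (u v : V) [DecidableRel (G.deleteEdges {s(u, v)}).Adj]
    {x : V → ℝ} (hx : x u = x v) :
    x ⬝ᵥ (G.deleteEdges {s(u, v)}).lapMatrix ℝ *ᵥ x = x ⬝ᵥ G.lapMatrix ℝ *ᵥ x := by
  rw [dotProduct_lapMatrix_mulVec, dotProduct_lapMatrix_mulVec]
  congr 1
  refine sum_congr rfl fun i _ => sum_congr rfl fun j _ => ?_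
  by_cases hij : s(i, j) = s(u, v)
  · have : x i = x j := by
      rcases Sym2.eq_iff.1 hij with ⟨rfl, rfl⟩ | ⟨rfl, rfl⟩
      · exact hx
      · exact hx.symm
    simp [this]
  · simp [deleteEdges_adj, hij]

/-- The Laplacian form of a bipartite graph, on vectors summing to zero over one part. -/
theorem dotProduct_lapMatrix_le_of_bipartition (A : Finset V)
    (hA : ∀ i j, G.Adj i j → (i ∈ A ↔ j ∉ A)) {M : ℝ} (h1 : (#A : ℝ) ≤ M) (h2 : (#Aᶜ : ℝ) ≤ M)
    {x : V → ℝ} (hx : ∑ i ∈ A, x i = 0) : x ⬝ᵥ G.lapMatrix ℝ *ᵥ x ≤ M * (x ⬝ᵥ x) := by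
  have hle : ∀ (i : V) (B : Finset V), (∀ j, G.Adj i j → j ∈ B) →
      (∑ j, if G.Adj i j then (x i - x j) ^ 2 else 0) ≤ ∑ j ∈ B, (x i - x j) ^ 2 := by
    intro i B hB
    rw [← sum_filter]
    exact sum_le_sum_of_subset_of_nonneg (fun j hj => hB j (by simpa using hj))
      (fun _ _ _ => sq_nonneg _)
  -- This is the form of the complete bipartite graph; its cross term has the factor `∑ i ∈ A, x i =
  -- 0`.
  have e : ∑ i ∈ A, ∑ j ∈ Aᶜ, (x i - x j) ^ 2
      = #Aᶜ * ∑ i ∈ A, x i ^ 2 + #A * ∑ j ∈ Aᶜ, x j ^ 2 := by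
    have : ∀ i j, (x i - x j) ^ 2 = x i ^ 2 + x j ^ 2 - 2 * (x i * x j) := fun i j => by ring
    simp_rw [this, sum_sub_distrib, sum_add_distrib, sum_const, ← mul_sum, nsmul_eq_mul]
    simp [← mul_sum, ← sum_mul, hx]
  have e' : ∑ i ∈ Aᶜ, ∑ j ∈ A, (x i - x j) ^ 2 = ∑ i ∈ A, ∑ j ∈ Aᶜ, (x i - x j) ^ 2 := by
    rw [sum_comm]
    exact sum_congr rfl fun i _ => sum_congr rfl fun j _ => by ring
  have hsum : (∑ i, ∑ j, if G.Adj i j then (x i - x j) ^ 2 else 0)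
      ≤ 2 * ∑ i ∈ A, ∑ j ∈ Aᶜ, (x i - x j) ^ 2 := by
    rw [← sum_add_sum_compl A, two_mul]
    nth_rw 2 [← e']
    exact add_le_add
      (sum_le_sum fun i hi => hle i _ fun j hj => by simpa using (hA i j hj).1 hi)
      (sum_le_sum fun i hi => hle i _ fun j hj => by
        by_contra hj'
        exact (mem_compl.1 hi) ((hA i j hj).2 hj'))
  have hxx : x ⬝ᵥ x = ∑ i ∈ A, x i ^ 2 + ∑ j ∈ Aᶜ, x j ^ 2 := by
    rw [sum_add_sum_compl, dotProduct]
    exact sum_congr rfl fun i _ => by ring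
  rw [dotProduct_lapMatrix_mulVec, hxx, mul_add]
  have p1 : 0 ≤ ∑ i ∈ A, x i ^ 2 := sum_nonneg fun _ _ => sq_nonneg _
  have p2 : 0 ≤ ∑ i ∈ Aᶜ, x i ^ 2 := sum_nonneg fun _ _ => sq_nonneg _
  have q1 := mul_le_mul_of_nonneg_right h2 p1
  have q2 := mul_le_mul_of_nonneg_right h1 p2
  linarith

end Laplacian

namespace IsShortestCycle

variable {V : Type*} {G : SimpleGraph V} {g : ℕ} {f : ℕ → V}

theorem card_image_range [DecidableEq V] (hf : IsShortestCycle G g f) : #((range g).image f) = g := by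
  rw [card_image_of_injOn, card_range]
  intro i hi j hj h
  exact hf.injOn (by simpa using hi) (by simpa using hj) h

theorem mem_image_range [DecidableEq V] (hf : IsShortestCycle G g f) {v : V} :
    v ∈ (range g).image f ↔ ∃ i, f i = v := by
  constructor
  · intro h
    obtain ⟨i, -, h⟩ := mem_image.1 h
    exact ⟨i, h⟩
  · rintro ⟨i, rfl⟩
    have h3 := hf.three_le
    exact mem_image.2 ⟨i % g, mem_range.2 (Nat.mod_lt _ (by omega)), (hf.eq_iff _ _).2 (by simp)⟩

theorem disjoint_neighborFinset [Fintype V] [DecidableRel G.Adj] (hf : IsShortestCycle G g f) (hg : 4 ≤ g) {u v : V}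
    (huv : G.Adj u v) : Disjoint (G.neighborFinset u) (G.neighborFinset v) := by
  rw [Finset.disjoint_left]
  intro w hu hv
  rw [mem_neighborFinset] at hu hv
  exact hf.not_triangle hg huv hv hu.symm

theorem le_card [Fintype V] (hf : IsShortestCycle G g f) : g ≤ Fintype.card V := by
  classical
  rw [← hf.card_image_range]
  exact card_le_univ _

/-- A connected graph with one vertex besides a shortest cycle. -/
theorem exists_pendant [Fintype V] (hG : G.Connected) (hf : IsShortestCycle G g f)
    (hn : Fintype.card V = g + 1) : ∃ f' w, IsShortestCycle G g f' ∧ (∀ i, f' i ≠ w) ∧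
      (∀ v, v ≠ w → ∃ i, f' i = v) ∧ G.Adj w (f' 0) := by
  classical
  have hcompl : #((range g).image f)ᶜ = 1 := by
    rw [card_compl, hf.card_image_range]
    omega
  obtain ⟨w, hw⟩ := card_eq_one.1 hcompl
  have hmem : ∀ v, (∃ i, f i = v) ↔ v ≠ w := fun v => by
    rw [← hf.mem_image_range, ← not_iff_not, not_not, ← mem_compl, hw, mem_singleton]
  have : Nontrivial V := by
    rw [← Fintype.one_lt_card_iff_nontrivial]
    have := hf.three_le
    omega
  obtain ⟨z, hz⟩ := hG.preconnected.exists_adj_of_nontrivial w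
  obtain ⟨a, rfl⟩ := (hmem z).2 hz.ne'
  refine ⟨_, w, hf.shift a, fun i => (hmem _).1 ⟨_, rfl⟩, fun v hv => ?_, hz⟩
  obtain ⟨i, rfl⟩ := (hmem v).2 hv
  obtain ⟨d, -, e⟩ := hf.exists_eq_add a i
  exact ⟨d, e.symm⟩

variable [Fintype V] [DecidableEq V] [DecidableRel G.Adj]

theorem degree_add_degree_le_card (hf : IsShortestCycle G g f) (hg : 4 ≤ g) {u v : V}
    (huv : G.Adj u v) : G.degree u + G.degree v ≤ Fintype.card V := by
  rw [← card_neighborFinset_eq_degree, ← card_neighborFinset_eq_degree,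
    ← card_union_of_disjoint (hf.disjoint_neighborFinset hg huv)]
  exact card_le_univ _

theorem card_neighborFinset_inter_le_two (hf : IsShortestCycle G g f) {u : V}
    (hu : u ∈ (range g).image f) : #(G.neighborFinset u ∩ (range g).image f) ≤ 2 := by
  obtain ⟨i, rfl⟩ := hf.mem_image_range.1 hu
  refine (card_le_card (t := {f (i + 1), f (i + (g - 1))}) fun w hw => ?_).trans card_le_two
  rw [mem_inter, mem_neighborFinset, hf.mem_image_range] at hw
  obtain ⟨h, j, rfl⟩ := hw
  simpa using hf.eq_of_adj_cycle h

theorem card_neighborFinset_inter_le_one (hf : IsShortestCycle G g f) (hg : 5 ≤ g) {u : V}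
    (hu : u ∉ (range g).image f) : #(G.neighborFinset u ∩ (range g).image f) ≤ 1 := by
  rw [hf.mem_image_range, not_exists] at hu
  rw [card_le_one]
  intro a ha b hb
  rw [mem_inter, mem_neighborFinset, hf.mem_image_range] at ha hb
  obtain ⟨ha, i, rfl⟩ := ha
  obtain ⟨hb, j, rfl⟩ := hb
  exact hf.eq_of_adj_of_adj hg hu ha hb

/-- Girth at least five: edges of degree sum more than `n - g + 3` lie on the shortest cycle, and
all other vertices are adjacent to one of their ends. -/
theorem degree_add_degree_le (hf : IsShortestCycle G g f) (hg : 5 ≤ g) {u v : V}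
    (huv : G.Adj u v) : G.degree u + G.degree v ≤ Fintype.card V - g + 3 ∨
      G.degree u + G.degree v = Fintype.card V - g + 4 ∧ ∀ w, (∀ i, f i ≠ w) →
        ((∃ i, f i = u) ∧ (∃ i, f i = v)) ∧ (G.Adj w u ∨ G.Adj w v) := by
  set S := (range g).image f with hS
  have hsplit : ∀ w, G.degree w = #(G.neighborFinset w ∩ S) + #(G.neighborFinset w \ S) := by
    intro w
    rw [← card_neighborFinset_eq_degree, card_inter_add_card_sdiff]
  have hcompl : #Sᶜ = Fintype.card V - g := by rw [card_compl, hf.card_image_range]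
  have hsub : (G.neighborFinset u \ S) ∪ (G.neighborFinset v \ S) ⊆ Sᶜ := by
    intro w hw
    simp only [mem_union, mem_sdiff] at hw
    rw [mem_compl]
    tauto
  have hcard : #(G.neighborFinset u \ S) + #(G.neighborFinset v \ S)
      = #((G.neighborFinset u \ S) ∪ (G.neighborFinset v \ S)) :=
    (card_union_of_disjoint ((hf.disjoint_neighborFinset (by omega) huv).mono
      sdiff_subset sdiff_subset)).symm
  have hle := card_le_card hsub
  rw [or_iff_not_imp_left]
  intro hgt
  -- The off-cycle neighbourhoods are disjoint and contribute at most `n - g`. A larger sum than `n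
  -- - g + 3` therefore needs two cycle neighbours at both ends, which puts both on the cycle, and
  -- leaves no off-cycle vertex uncovered.
  have two : ∀ z, #(G.neighborFinset z ∩ S) ≤ 2 := fun z => by
    by_cases hz : z ∈ S
    · exact hf.card_neighborFinset_inter_le_two hz
    · exact (hf.card_neighborFinset_inter_le_one hg hz).trans one_le_two
  have hu2 := two u
  have hv2 := two v
  have hu' := hsplit u
  have hv' := hsplit v
  have huS : u ∈ S := by
    by_contra h
    have : #(G.neighborFinset u ∩ S) ≤ 1 := hf.card_neighborFinset_inter_le_one hg h
    omega
  have hvS : v ∈ S := by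
    by_contra h
    have : #(G.neighborFinset v ∩ S) ≤ 1 := hf.card_neighborFinset_inter_le_one hg h
    omega
  refine ⟨by omega, fun w hw => ⟨⟨hf.mem_image_range.1 huS, hf.mem_image_range.1 hvS⟩, ?_⟩⟩
  have heq := eq_of_subset_of_card_le hsub (by omega)
  have hwS : w ∈ Sᶜ := by
    rw [mem_compl, hf.mem_image_range, not_exists]
    exact hw
  rw [← heq] at hwS
  simp only [mem_union, mem_sdiff, mem_neighborFinset] at hwS
  exact hwS.imp (fun h => h.1.symm) (fun h => h.1.symm)

theorem exists_form_le_on_hyperplane_of_five_le (hf : IsShortestCycle G g f) (hg : 5 ≤ g)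
    (hn : g + 1 ≤ Fintype.card V) : ∃ l : V → ℝ, ∀ x : V → ℝ, l ⬝ᵥ x = 0 →
      x ⬝ᵥ G.lapMatrix ℝ *ᵥ x ≤ (Fintype.card V - g + 3 : ℕ) * (x ⬝ᵥ x) := by
  classical
  by_cases hall : ∀ u v, G.Adj u v → G.degree u + G.degree v ≤ Fintype.card V - g + 3
  -- For `l = 0` the bound holds on the whole space.
  · exact ⟨0, fun x _ => G.dotProduct_lapMatrix_le_of_degree_add_degree_le hall x⟩
  push Not at hall
  obtain ⟨u, v, huv, hlt⟩ := hall
  refine ⟨Pi.single u 1 - Pi.single v 1, fun x hx => ?_⟩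
  rw [sub_dotProduct, single_one_dotProduct, single_one_dotProduct, sub_eq_zero] at hx
  rw [← dotProduct_lapMatrix_deleteEdges u v hx]
  refine dotProduct_lapMatrix_le_of_degree_add_degree_le _ (fun a b hab => ?_) x
  obtain ⟨w, hw⟩ : ∃ w, w ∉ (range g).image f := by
    by_contra! h
    have := hf.card_image_range
    rw [eq_univ_of_forall h, card_univ] at this
    omega
  rw [hf.mem_image_range, not_exists] at hw
  have hab' := (deleteEdges_adj.1 hab).1
  have da := degree_deleteEdges_le (G := G) (s := {s(u, v)}) a
  have db := degree_deleteEdges_le (G := G) (s := {s(u, v)}) b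
  rcases hf.degree_add_degree_le hg hab' with h | ⟨h, h'⟩
  · omega
  rcases hf.degree_add_degree_le hg huv with k | ⟨k, k'⟩
  · omega
  obtain ⟨⟨⟨i, rfl⟩, ⟨j, rfl⟩⟩, hw1⟩ := h' w hw
  obtain ⟨⟨⟨i', rfl⟩, ⟨j', rfl⟩⟩, hw2⟩ := k' w hw
  -- An off-cycle vertex `w` is adjacent to an end of each of the two edges but has only one
  -- neighbour on the cycle, so they share it. Deleting `uv` then lowers the degree sum of the other
  -- edge.
  have hmeet : (f i = f i' ∨ f i = f j') ∨ (f j = f i' ∨ f j = f j') := by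
    rcases hw1 with hw1 | hw1 <;> rcases hw2 with hw2 | hw2 <;>
      have := hf.eq_of_adj_of_adj hg hw hw1 hw2 <;> tauto
  rcases hmeet with hm | hm
  · have := degree_deleteEdges_add_one_le huv hm
    omega
  · have := degree_deleteEdges_add_one_le huv hm
    omega

/-- The threshold is `n - 1`, so an edge beyond it has degree sum `n`: its two neighbourhoods
partition the vertices, and they are independent because there are no triangles. Both parts are
nonempty, hence of size at most `n - 1`. -/
theorem exists_form_le_on_hyperplane_of_eq_four (hf : IsShortestCycle G 4 f) :
    ∃ l : V → ℝ, ∀ x : V → ℝ, l ⬝ᵥ x = 0 →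
      x ⬝ᵥ G.lapMatrix ℝ *ᵥ x ≤ (Fintype.card V - 4 + 3 : ℕ) * (x ⬝ᵥ x) := by
  have hn := hf.le_card
  by_cases hall : ∀ u v, G.Adj u v → G.degree u + G.degree v ≤ Fintype.card V - 4 + 3
  · exact ⟨0, fun x _ => G.dotProduct_lapMatrix_le_of_degree_add_degree_le hall x⟩
  push Not at hall
  obtain ⟨u, v, huv, hlt⟩ := hall
  have hun : G.neighborFinset u ∪ G.neighborFinset v = univ := by
    rw [← card_eq_iff_eq_univ]
    apply le_antisymm (card_le_univ _)
    rw [card_union_of_disjoint (hf.disjoint_neighborFinset le_rfl huv),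
      card_neighborFinset_eq_degree, card_neighborFinset_eq_degree]
    omega
  have hun' : ∀ w, ¬ G.Adj v w → G.Adj u w := fun w hw => by
    have := mem_univ w
    rw [← hun, mem_union, mem_neighborFinset, mem_neighborFinset] at this
    tauto
  have hA : ∀ i j, G.Adj i j → (i ∈ G.neighborFinset v ↔ j ∉ G.neighborFinset v) := by
    intro i j hij
    rw [mem_neighborFinset, mem_neighborFinset]
    refine ⟨fun hi hj => hf.not_triangle le_rfl hi hij hj.symm, fun hj => ?_⟩
    by_contra hi
    exact hf.not_triangle le_rfl (hun' i hi) hij (hun' j hj).symm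
  have hcard := card_add_card_compl (G.neighborFinset v)
  have h1 : 0 < #(G.neighborFinset v) := card_pos.2 ⟨u, by simpa using huv.symm⟩
  have h2 : 0 < #(G.neighborFinset v)ᶜ := card_pos.2 ⟨v, by simp⟩
  refine ⟨fun i => if i ∈ G.neighborFinset v then 1 else 0, fun x hx => ?_⟩
  refine dotProduct_lapMatrix_le_of_bipartition (G.neighborFinset v) hA ?_ ?_ ?_
  · exact_mod_cast (by omega : #(G.neighborFinset v) ≤ Fintype.card V - 4 + 3)
  · exact_mod_cast (by omega : #(G.neighborFinset v)ᶜ ≤ Fintype.card V - 4 + 3)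
  · rw [← hx, dotProduct]
    simp only [ite_mul, one_mul, zero_mul, sum_ite_mem, univ_inter]

/-- At most one Laplacian eigenvalue exceeds `n - g + 3` if `4 ≤ g < n`. -/
theorem eigenvalues_le (hf : IsShortestCycle G g f) (hg : 4 ≤ g)
    (hn : g + 1 ≤ Fintype.card V) {i j : V} (hij : i ≠ j)
    (hi : ((Fintype.card V - g + 3 : ℕ) : ℝ) < (G.isHermitian_lapMatrix (R := ℝ)).eigenvalues i) :
    (G.isHermitian_lapMatrix (R := ℝ)).eigenvalues j ≤ (Fintype.card V - g + 3 : ℕ) := by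
  obtain ⟨l, hl⟩ : ∃ l : V → ℝ, ∀ x : V → ℝ, l ⬝ᵥ x = 0 →
      x ⬝ᵥ G.lapMatrix ℝ *ᵥ x ≤ (Fintype.card V - g + 3 : ℕ) * (x ⬝ᵥ x) := by
    rcases Nat.lt_or_ge g 5 with h | h
    · obtain rfl : g = 4 := by omega
      exact hf.exists_form_le_on_hyperplane_of_eq_four
    · exact hf.exists_form_le_on_hyperplane_of_five_le h hn
  exact Matrix.IsHermitian.eigenvalues_le_of_form_le_on_hyperplane _ l hl hij hi

theorem eigenvalues_le_card (hf : IsShortestCycle G g f) (hg : 4 ≤ g) (i : V) :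
    (G.isHermitian_lapMatrix (R := ℝ)).eigenvalues i ≤ Fintype.card V :=
  G.eigenvalues_lapMatrix_le_of_degree_add_degree_le
    (fun _ _ h => hf.degree_add_degree_le_card hg h) i

theorem exists_degree_add_one_lt_eigenvalues (hf : IsShortestCycle G g f) (hg : 4 ≤ g) :
    ∃ i, (G.degree (f 0) + 1 : ℝ) < (G.isHermitian_lapMatrix (R := ℝ)).eigenvalues i :=
  G.exists_degree_add_one_lt_eigenvalues (hf.adj_succ 0) (hf.adj_succ 1)
    (fun h => absurd (hf.injOn (by omega) (by omega) h) (by omega))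
    (hf.not_adj_zero le_rfl (by omega))

theorem two_le_degree (hf : IsShortestCycle G g f) : 2 ≤ G.degree (f 0) := by
  have h3 := hf.three_le
  have hne : f 1 ≠ f (g - 1) := fun h => by
    have := hf.injOn (by omega) (by omega) h
    omega
  rw [← card_neighborFinset_eq_degree, ← card_pair hne]
  apply card_le_card
  intro a ha
  rcases mem_insert.1 ha with rfl | ha
  · simpa using hf.adj_succ 0
  · rw [mem_singleton.1 ha]
    simpa using hf.adj_pred

theorem three_le_degree (hf : IsShortestCycle G g f) {w : V} (hw : ∀ i, f i ≠ w)
    (h0 : G.Adj w (f 0)) : 3 ≤ G.degree (f 0) := by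
  have h3 := hf.three_le
  have hne : f 1 ≠ f (g - 1) := fun h => by
    have := hf.injOn (by omega) (by omega) h
    omega
  rw [← card_neighborFinset_eq_degree,
    ← card_eq_three.2 ⟨f 1, f (g - 1), w, hne, hw 1, hw (g - 1), rfl⟩]
  apply card_le_card
  intro a ha
  simp only [mem_insert, mem_singleton] at ha
  rw [mem_neighborFinset]
  rcases ha with rfl | rfl | rfl
  · exact hf.adj_succ 0
  · exact hf.adj_pred
  · exact h0.symm

end IsShortestCycle

end SimpleGraph

/-! ### Graphs whose order exceeds the girth by at most one. -/

namespace SimpleGraph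

open Finset

theorem egirth_completeBipartiteGraph_three_two :
    (completeBipartiteGraph (Fin 3) (Fin 2)).egirth = 4 := by
  set K := completeBipartiteGraph (Fin 3) (Fin 2) with hK
  have hle : K.egirth ≤ 4 := by
    refine egirth_le_of_closed_sequence (m := 4) (by omega)
      (fun i => if i = 0 then .inl 0 else if i = 1 then .inr 0 else if i = 2 then .inl 1
        else .inr 1) ?_ ?_ ?_
    · intro i j hi hj hij
      interval_cases i <;> interval_cases j <;> simp_all
    · intro i hi
      obtain rfl | rfl | rfl : i = 0 ∨ i = 1 ∨ i = 2 := by omega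
      all_goals simp [hK]
    · simp [hK]
  obtain ⟨g, hg⟩ := ENat.ne_top_iff_exists.1 (ne_top_of_le_ne_top (by simp) hle)
  obtain ⟨f, hf⟩ := exists_isShortestCycle hg.symm
  have hg4 : g ≤ 4 := by
    rw [← hg] at hle
    exact_mod_cast hle
  have hg3 := hf.three_le
  have : g ≠ 3 := by
    rintro rfl
    have h1 := hf.adj_succ 0
    have h2 := hf.adj_succ 1
    have h3 := hf.adj_pred
    simp only [hK, completeBipartiteGraph_adj, Nat.zero_add, Nat.reduceAdd, Nat.reduceSub]
      at h1 h2 h3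
    generalize f 0 = a at h1 h3
    generalize f 1 = b at h1 h2
    generalize f 2 = c at h2 h3
    rcases a with _ | _ <;> rcases b with _ | _ <;> rcases c with _ | _ <;> simp_all
  rw [← hg, show g = 4 by omega]
  rfl

/-- A shortest cycle avoids `none`, which has only one neighbour, and with each vertex it contains
both of that vertex's neighbours on the `k`-cycle. So it passes through all `k` vertices. -/
theorem egirth_cycleWithPendant {k : ℕ} (hk : 3 ≤ k) : (cycleWithPendant k).egirth = k := by
  have hle : (cycleWithPendant k).egirth ≤ k := by
    have hlt : ∀ i, i % k < k := fun i => Nat.mod_lt _ (by omega)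
    refine egirth_le_of_closed_sequence hk (fun i => some ⟨i % k, hlt i⟩) ?_ ?_ ?_
    · intro i j hi hj hij
      simpa [Nat.mod_eq_of_lt hi, Nat.mod_eq_of_lt hj] using hij
    · intro i hi
      refine (cycleGraph_adj_iff_succ (by omega)).2 (Or.inl (Or.inl ?_))
      simp only [Nat.mod_eq_of_lt hi, Nat.mod_eq_of_lt (show i < k by omega)]
    · refine (cycleGraph_adj_iff_succ (by omega)).2 (Or.inr (Or.inr ⟨?_, ?_⟩))
      · simp
      · simp only [Nat.mod_eq_of_lt (show k - 1 < k by omega)]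
        omega
  refine le_antisymm hle ?_
  obtain ⟨g, hg⟩ := ENat.ne_top_iff_exists.1 (ne_top_of_le_ne_top (by simp) hle)
  obtain ⟨f, hf⟩ := exists_isShortestCycle hg.symm
  have hg3 := hf.three_le
  have hdist : ∀ i, f (i + 1) ≠ f (i + (g - 1)) := fun i h => by
    have := (hf.shift i).injOn (by omega) (by omega) h
    omega
  have hpred : ∀ i, (cycleWithPendant k).Adj (f i) (f (i + (g - 1))) :=
    fun i => (hf.shift i).adj_pred
  have hsome : ∀ i, ∃ m, f i = some m := by
    intro i
    by_contra! hc
    have hi : f i = none := Option.eq_none_iff_forall_ne_some.2 hc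
    have key : ∀ v, (cycleWithPendant k).Adj none v → v = some ⟨0, by omega⟩ := by
      rintro (_ | j) hj
      · exact hj.elim
      · exact congrArg some (Fin.ext hj)
    have h1 := hf.adj_succ i
    have h2 := hpred i
    rw [hi] at h1 h2
    exact hdist i ((key _ h1).trans (key _ h2).symm)
  have hnext : ∀ m : Fin k, (∃ i, f i = some m) → ∀ m' : Fin k,
      (m'.val = m.val + 1 ∨ m'.val = 0 ∧ m.val + 1 = k) → ∃ i, f i = some m' := by
    rintro m ⟨i, hi⟩ m' hm'
    obtain ⟨a, ha⟩ := hsome (i + 1)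
    obtain ⟨b, hb⟩ := hsome (i + (g - 1))
    have h1 := hf.adj_succ i
    have h2 := hpred i
    have hab := hdist i
    rw [hi, ha] at h1
    rw [hi, hb] at h2
    rw [ha, hb, Ne, Option.some_inj, Fin.ext_iff] at hab
    replace h1 := (cycleGraph_adj_iff_succ (by omega)).1 h1
    replace h2 := (cycleGraph_adj_iff_succ (by omega)).1 h2
    have hor : m'.val = a.val ∨ m'.val = b.val := by
      have := a.isLt
      have := b.isLt
      have := m.isLt
      omega
    rcases hor with h | h
    · exact ⟨_, by rw [ha, Fin.ext h]⟩
    · exact ⟨_, by rw [hb, Fin.ext h]⟩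
  -- `hnext` only moves to the successor: climb to `k - 1`, then wrap around.
  have hzero : ∃ i, f i = some ⟨0, by omega⟩ := by
    obtain ⟨m, hm⟩ := hsome 0
    have up : ∀ t, ∀ ht : m.val + t < k, ∃ i, f i = some ⟨m.val + t, ht⟩ := by
      intro t
      induction t with
      | zero => exact fun _ => ⟨0, hm⟩
      | succ t ih => exact fun ht => hnext _ (ih (by omega)) _ (Or.inl rfl)
    have := m.isLt
    exact hnext _ (up (k - 1 - m.val) (by omega)) _ (Or.inr ⟨rfl, by simp only; omega⟩)
  have hall : ∀ t, ∀ ht : t < k, ∃ i, f i = some ⟨t, ht⟩ := by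
    intro t
    induction t with
    | zero => exact fun _ => hzero
    | succ t ih => exact fun ht => hnext _ (ih (by omega)) _ (Or.inl rfl)
  have hcard : k ≤ g := by
    rw [← hf.card_image_range]
    calc k = #((univ : Finset (Fin k)).image some) := by
          rw [card_image_of_injective _ (Option.some_injective _), card_univ, Fintype.card_fin]
      _ ≤ _ := card_le_card fun v hv => by
          obtain ⟨m, -, rfl⟩ := mem_image.1 hv
          exact hf.mem_image_range.2 (hall m.val m.isLt)
  rw [← hg]
  exact_mod_cast hcard

namespace IsShortestCycle

variable {V : Type*} [Fintype V] {G : SimpleGraph V} {g : ℕ} {f : ℕ → V}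

theorem nonempty_iso_cycleGraph (hf : IsShortestCycle G g f) (hn : Fintype.card V = g) :
    Nonempty (G ≃g cycleGraph g) := by
  have hb : Function.Bijective (fun i : Fin g => f i) := by
    rw [Fintype.bijective_iff_injective_and_card, Fintype.card_fin]
    exact ⟨fun i j h => Fin.ext (hf.injOn i.isLt j.isLt h), hn.symm⟩
  exact ⟨RelIso.symm ⟨Equiv.ofBijective _ hb, hf.adj_iff⟩⟩

theorem nonempty_iso_cycleWithPendant (hf : IsShortestCycle G g f) (hn : Fintype.card V = g + 1)
    {w : V} (hw : ∀ i, f i ≠ w) (h0 : G.Adj w (f 0)) (huniq : ∀ i, G.Adj w (f i) → f i = f 0) :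
    Nonempty (G ≃g cycleWithPendant g) := by
  have h3 := hf.three_le
  let φ : Option (Fin g) → V := fun o => o.elim w fun i => f i
  have hb : Function.Bijective φ := by
    rw [Fintype.bijective_iff_injective_and_card, Fintype.card_option, Fintype.card_fin]
    refine ⟨?_, hn.symm⟩
    rintro (_ | i) (_ | j) h
    · rfl
    · exact absurd h.symm (hw j)
    · exact absurd h (hw i)
    · exact congrArg some (Fin.ext (hf.injOn i.isLt j.isLt h))
  have hadj : ∀ i : Fin g, G.Adj w (f i) ↔ i.val = 0 := fun i => by
    refine ⟨fun h => hf.injOn i.isLt (by omega) (huniq i h), fun h => ?_⟩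
    rwa [h]
  refine ⟨RelIso.symm ⟨Equiv.ofBijective φ hb, ?_⟩⟩
  rintro (_ | i) (_ | j)
  · exact ⟨fun h => h.ne rfl, fun h => h.elim⟩
  · exact hadj j
  · exact G.adj_comm _ _ |>.trans (hadj i)
  · exact hf.adj_iff

theorem nonempty_iso_completeBipartiteGraph (hf : IsShortestCycle G 4 f)
    (hn : Fintype.card V = 5) {w : V} (hw : ∀ i, f i ≠ w) (h0 : G.Adj w (f 0))
    (h2 : G.Adj w (f 2)) : Nonempty (G ≃g completeBipartiteGraph (Fin 3) (Fin 2)) := by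
  let φ : Fin 3 ⊕ Fin 2 → V := Sum.elim ![w, f 1, f 3] ![f 0, f 2]
  have n1 : ¬ G.Adj w (f 1) := fun h => hf.not_triangle le_rfl h0 (hf.adj_succ 0) h.symm
  have n3 : ¬ G.Adj w (f 3) := fun h => hf.not_triangle le_rfl h2 (hf.adj_succ 2) h.symm
  have n02 : ¬ G.Adj (f 0) (f 2) := hf.not_adj_zero le_rfl (by omega)
  have n13 : ¬ G.Adj (f 1) (f 3) := (hf.shift 1).not_adj_zero (d := 2) le_rfl (by omega)
  have a01 := hf.adj_succ 0
  have a12 := hf.adj_succ 1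
  have a23 := hf.adj_succ 2
  have a03 := hf.adj_pred
  simp only [Nat.zero_add, Nat.reduceAdd, Nat.reduceSub] at a01 a12 a23 a03
  have hadj : ∀ a b, G.Adj (φ a) (φ b) ↔ (completeBipartiteGraph (Fin 3) (Fin 2)).Adj a b := by
    rintro (a | a) (b | b) <;> fin_cases a <;> fin_cases b <;>
      simp [φ, n1, n3, n02, n13, a01, a12, a23, a03, h0, h2, G.adj_comm (f 1) w,
        G.adj_comm (f 3) w, G.adj_comm (f 2) (f 0), G.adj_comm (f 3) (f 1), a01.symm, a12.symm,
        a23.symm, a03.symm, h0.symm, h2.symm]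
  have hb : Function.Bijective φ := by
    rw [Fintype.bijective_iff_injective_and_card]
    refine ⟨?_, by simp [hn]⟩
    have e : ∀ i j, i < 4 → j < 4 → f i = f j → i = j := fun i j hi hj => hf.injOn hi hj
    rintro (a | a) (b | b) h <;> fin_cases a <;> fin_cases b <;>
      simp only [φ, Sum.elim_inl, Sum.elim_inr, Fin.zero_eta, Fin.mk_one, Fin.reduceFinMk,
        Matrix.cons_val] at h <;>
      first
        | rfl
        | exact absurd h (hw _)
        | exact absurd h.symm (hw _)
        | exact absurd (e _ _ (by omega) (by omega) h) (by omega)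
  exact ⟨RelIso.symm ⟨Equiv.ofBijective φ hb, hadj _ _⟩⟩

end IsShortestCycle

/-- The graphs whose order is one more than their girth, for girth at least four. -/
theorem card_eq_girth_add_one_iff {V : Type*} [Fintype V] {G : SimpleGraph V} (hG : G.Connected)
    {g : ℕ} (hg : G.egirth = g) : (4 ≤ g ∧ Fintype.card V = g + 1) ↔
      Nonempty (G ≃g completeBipartiteGraph (Fin 3) (Fin 2)) ∨
      ∃ k : ℕ, 4 ≤ k ∧ Nonempty (G ≃g cycleWithPendant k) := by
  classical
  constructor
  · rintro ⟨h4, hn⟩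
    obtain ⟨f₀, hf₀⟩ := exists_isShortestCycle hg
    obtain ⟨f, w, hf, hw, -, h0⟩ := hf₀.exists_pendant hG hn
    by_cases huniq : ∀ i, G.Adj w (f i) → f i = f 0
    · exact Or.inr ⟨g, h4, hf.nonempty_iso_cycleWithPendant hn hw h0 huniq⟩
    · push Not at huniq
      obtain ⟨i, hi, hne⟩ := huniq
      obtain ⟨d, hd, e⟩ := hf.exists_eq_add 0 i
      rw [Nat.zero_add] at e
      rw [e] at hi hne
      have hpos : 1 ≤ d := by
        by_contra hd0
        exact hne (by rw [show d = 0 by omega])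
      obtain ⟨rfl, rfl⟩ := hf.eq_two_of_adj_zero_of_adj h4 hw hpos hd h0 hi
      exact Or.inl (hf.nonempty_iso_completeBipartiteGraph hn hw h0 hi)
  · rintro (⟨⟨φ⟩⟩ | ⟨k, hk, ⟨φ⟩⟩)
    · have h := φ.egirth_eq
      rw [hg, egirth_completeBipartiteGraph_three_two] at h
      have hg4 : g = 4 := by exact_mod_cast h
      have := Fintype.card_congr φ.toEquiv
      simp only [Fintype.card_sum, Fintype.card_fin] at this
      omega
    · have h := φ.egirth_eq
      rw [hg, egirth_cycleWithPendant (by omega)] at h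
      have hgk : g = k := by exact_mod_cast h
      have := Fintype.card_congr φ.toEquiv
      simp only [Fintype.card_option, Fintype.card_fin] at this
      omega

/-- The graphs whose order and girth are three. -/
theorem card_eq_girth_eq_three_iff {V : Type*} [Fintype V] {G : SimpleGraph V} {g : ℕ}
    (hg : G.egirth = g) : (g = 3 ∧ Fintype.card V = 3) ↔ Nonempty (G ≃g cycleGraph 3) := by
  constructor
  · rintro ⟨rfl, hn⟩
    obtain ⟨f, hf⟩ := exists_isShortestCycle hg
    exact hf.nonempty_iso_cycleGraph hn
  · rintro ⟨φ⟩
    have h := φ.egirth_eq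
    rw [hg, cycleGraph_three_eq_top, egirth_top (by simp)] at h
    exact ⟨by exact_mod_cast h, by simpa using Fintype.card_congr φ.toEquiv⟩

end SimpleGraph

/-! ### Counting eigenvalues in the interval. -/

section Count

open SimpleGraph

variable {V : Type*} [Fintype V] [DecidableEq V] {G : SimpleGraph V} [DecidableRel G.Adj]
  {g : ℕ} {f : ℕ → V}

theorem laplacianEigenvalueCount_Ioc (a b : ℝ) :
    laplacianEigenvalueCount G (Set.Ioc (a : EReal) (b : EReal)) =
      Set.ncard {i : V | a < (G.isHermitian_lapMatrix (R := ℝ)).eigenvalues i ∧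
        (G.isHermitian_lapMatrix (R := ℝ)).eigenvalues i ≤ b} := by
  simp only [laplacianEigenvalueCount, Set.mem_Ioc, EReal.coe_lt_coe_iff, EReal.coe_le_coe_iff]

theorem SimpleGraph.IsShortestCycle.laplacianEigenvalueCount_le_one (hf : IsShortestCycle G g f)
    (hg : 4 ≤ g) (hn : g + 1 ≤ Fintype.card V) (b : ℝ) :
    laplacianEigenvalueCount G
      (Set.Ioc (((Fintype.card V - g + 3 : ℕ) : ℝ) : EReal) (b : EReal)) ≤ 1 := by
  rw [laplacianEigenvalueCount_Ioc, Set.ncard_le_one]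
  rintro i ⟨hi, -⟩ j ⟨hj, -⟩
  by_contra hij
  exact absurd (hf.eigenvalues_le hg hn hij hi) (not_le.2 hj)

theorem SimpleGraph.IsShortestCycle.laplacianEigenvalueCount_pos (hf : IsShortestCycle G g f)
    (hg : 4 ≤ g) {a : ℝ} (ha : a ≤ G.degree (f 0) + 1) :
    0 < laplacianEigenvalueCount G (Set.Ioc (a : EReal) ((Fintype.card V : ℝ) : EReal)) := by
  rw [laplacianEigenvalueCount_Ioc, Set.ncard_pos]
  obtain ⟨i, hi⟩ := hf.exists_degree_add_one_lt_eigenvalues hg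
  exact ⟨i, ha.trans_lt hi, hf.eigenvalues_le_card hg i⟩

/-- The additive form of the equality avoids truncated subtraction. -/
theorem SimpleGraph.Connected.laplacianEigenvalueCount_add_girth_eq_card_iff (hG : G.Connected)
    (hg : G.egirth = g) :
    laplacianEigenvalueCount G (Set.Ioc (((Fintype.card V - g + 3 : ℕ) : ℝ) : EReal)
        ((Fintype.card V : ℝ) : EReal)) + g = Fintype.card V ↔
      (g = 3 ∧ Fintype.card V = 3) ∨ (4 ≤ g ∧ Fintype.card V = g + 1) := by
  obtain ⟨f, hf⟩ := exists_isShortestCycle hg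
  have h3 := hf.three_le
  have hn := hf.le_card
  obtain rfl | h4 : g = 3 ∨ 4 ≤ g := by omega
  · rw [show Fintype.card V - 3 + 3 = Fintype.card V by omega, Set.Ioc_self]
    have : laplacianEigenvalueCount G (∅ : Set EReal) = 0 := by simp [laplacianEigenvalueCount]
    omega
  · obtain h | h | h : Fintype.card V = g ∨ Fintype.card V = g + 1 ∨ g + 2 ≤ Fintype.card V := by
      omega
    -- The threshold is `3 ≤ deg + 1`, so the count is not 0.
    · have := hf.laplacianEigenvalueCount_pos h4 (a := (Fintype.card V - g + 3 : ℕ)) (by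
        have := hf.two_le_degree
        exact_mod_cast (by omega : Fintype.card V - g + 3 ≤ G.degree (f 0) + 1))
      omega
    · obtain ⟨f', w, hf', hw, -, h0⟩ := hf.exists_pendant hG h
      have := hf'.laplacianEigenvalueCount_pos h4 (a := (Fintype.card V - g + 3 : ℕ)) (by
        have := hf'.three_le_degree hw h0
        exact_mod_cast (by omega : Fintype.card V - g + 3 ≤ G.degree (f' 0) + 1))
      have := hf.laplacianEigenvalueCount_le_one h4 h.ge (Fintype.card V)
      omega
    -- The count is at most 1, while `n - g ≥ 2`.
    · have := hf.laplacianEigenvalueCount_le_one h4 (by omega) (Fintype.card V)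
      omega

end Count

theorem theorem3p2 {V : Type*} [Fintype V] [DecidableEq V] (G : SimpleGraph V)
    [DecidableRel G.Adj] (hG : G.Connected) :
    (laplacianEigenvalueCount G
        (Set.Ioc ((Fintype.card V : EReal) - girthEReal G + 3) (Fintype.card V : EReal)) : EReal) =
        (Fintype.card V : EReal) - girthEReal G ↔
      Nonempty (G ≃g SimpleGraph.cycleGraph 3) ∨
      Nonempty (G ≃g completeBipartiteGraph (Fin 3) (Fin 2)) ∨
      ∃ k : ℕ, 4 ≤ k ∧ Nonempty (G ≃g cycleWithPendant k) := by
  by_cases htop : G.egirth = ⊤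
  · have hgirth : girthEReal G = ⊤ := by simp [girthEReal, htop]
    rw [hgirth, EReal.sub_top]
    refine iff_of_false (EReal.natCast_ne_bot _) ?_
    rintro (⟨⟨φ⟩⟩ | ⟨⟨φ⟩⟩ | ⟨k, hk, ⟨φ⟩⟩)
    · rw [φ.egirth_eq, SimpleGraph.cycleGraph_three_eq_top,
        SimpleGraph.egirth_top (by simp)] at htop
      simp at htop
    · rw [φ.egirth_eq, SimpleGraph.egirth_completeBipartiteGraph_three_two] at htop
      simp at htop
    · rw [φ.egirth_eq, SimpleGraph.egirth_cycleWithPendant (by omega)] at htop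
      simp at htop
  obtain ⟨g, hg⟩ := ENat.ne_top_iff_exists.1 htop
  have hgirth : girthEReal G = ((g : ℝ) : EReal) := by
    rw [girthEReal, ← hg]
    rfl
  obtain ⟨f, hf⟩ := SimpleGraph.exists_isShortestCycle hg.symm
  have hn := hf.le_card
  -- Since `g ≤ n`, the natural subtraction is exact.
  have hlow : (Fintype.card V : EReal) - girthEReal G + 3
      = (((Fintype.card V - g + 3 : ℕ) : ℝ) : EReal) := by
    rw [hgirth]
    push_cast [hn]
    rfl
  rw [← SimpleGraph.card_eq_girth_add_one_iff hG hg.symm,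
    ← SimpleGraph.card_eq_girth_eq_three_iff hg.symm,
    ← hG.laplacianEigenvalueCount_add_girth_eq_card_iff hg.symm, hlow, hgirth]
  set c := laplacianEigenvalueCount G _ with hc
  have hcard : (Fintype.card V : EReal) = ((Fintype.card V : ℝ) : EReal) := by simp
  rw [show (laplacianEigenvalueCount G (Set.Ioc (((Fintype.card V - g + 3 : ℕ) : ℝ) : EReal)
    ((Fintype.card V : ℝ) : EReal))) = c by rw [hc, hcard]]
  rw [hcard, show (c : EReal) = ((c : ℝ) : EReal) by simp, ← EReal.coe_sub, EReal.coe_eq_coe_iff,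
    eq_sub_iff_add_eq]
  norm_cast
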